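/- Let $\mathcal{I}S$ be the category whose objects are the intervals $\langle n\rangle=\{-1,0,\ldots,n,n+1\}$, $n\ge -1$, and whose morphisms $\langle m\rangle\to\langle n\rangle$ are maps $f$ with $f(-1)=-1$ and $f(m+1)=n+1$, together with a linear order on each non-empty fibre $f^{-1}(i)$ such that $-1$ is minimal in $f^{-1}(-1)$ and $m+1$ is maximal in $f^{-1}(n+1)$; the fibres of a composite $g\circ f$ carry the order in which $(g\circ f)^{-1}(k)$ is the ordered sum of the fibres $f^{-1}(j)$, $j\in g^{-1}(k)$. The category $\mathcal{I}$ of intervals and non-decreasing endpoint-preserving maps is contained in $\mathcal{I}S$ (each fibre with its natural order). Joyal's duality identifies $\mathcal{I}$ with $\Delta^{\mathrm{op}}$, the ordinal $[n]$ corresponding to $\langle n-1\rangle$, which gives a functor $\Delta\to(\mathcal{I}S)^{\mathrm{op}}$. Let $\mathrm{Chain}$ be the category of $\mathbb{Z}$-graded chain complexes of abelian groups. An $\mathcal{S}$-chain complex is a functor $(\mathcal{I}S)^{\mathrm{op}}\to\mathrm{Chain}$. Let $F_{\mathcal S}$ be the left adjoint of the restriction functor from $\mathcal{S}$-chain complexes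 to cosimplicial chain complexes, and let $\iota\colon C\to F_{\mathcal S}(C)$ be the unit of the adjunction. For a cosimplicial chain complex $C=C^\bullet_*$ with vertical differential $\partial\colon C^n_{k+1}\to C^n_k$ and cofaces $d_i$, put $d(c)=\sum_{i=0}^{n+1}(-1)^{i+k}d_i(c)$ for $c\in C^n_k$. Let $\overline{\mathrm{Tot}}(C)^*$ be the cochain complex of abelian groups with $\overline{\mathrm{Tot}}(C)^m=\prod_{n-k=m}C^n_k$ and differential $(a^0,a^1,a^2,\ldots)\mapsto(-\partial a^0,\;da^0-\partial a^1,\;da^1-\partial a^2,\ldots)$. **Theorem.** On the category of cosimplicial chain complexes $C$ such that every $C^n_k$ is a finitely generated torsion-free abelian group (with cosimplicial chain maps as morphisms), there is a natural cochain homotopy equivalence $$\overline{\mathrm{Tot}}(F_{\mathcal S}(C))^*\;\simeq\;\overline{\mathrm{Tot}}(C)^* ,$$ that is, there are cochain maps in both directions, natural in $C$, whose two composites are homotopic to the identities by cochain homotopies that are natural in $C$. The map $\overline{\mathrm{Tot}}(C)^*\to\overline{\mathrm{Tot}}(F_{\mathcal S}(C))^*$ can be taken to be $\overline{\mathrm{Tot}}(\iota)$.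 -/

import Mathlib

open CategoryTheory

universe u v w

/-! ### The category `IS` -/

/-- A morphism `⟨m-1⟩ → ⟨n-1⟩` of the category `IS`.

The interval `⟨n-1⟩ = {-1, 0, …, n-1, n}` is represented by `Fin (n + 2)`: the element `i` of the
interval is the element `i + 1` of `Fin (n + 2)`, so that the two boundary points are `0` and
`Fin.last (n + 1)`. A morphism is a map together with a linear order on each of its fibres. The
orders are recorded by one relation `le`, which relates only elements of the same fibre. -/
@[ext]
structure ISHom (m n : ℕ) where
  toFun : Fin (m + 2) → Fin (n + 2)
  le : Fin (m + 2) → Fin (m + 2) → Prop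
  eq_of_le : ∀ a b, le a b → toFun a = toFun b
  le_refl : ∀ a, le a a
  le_trans : ∀ a b c, le a b → le b c → le a c
  le_antisymm : ∀ a b, le a b → le b a → a = b
  le_total : ∀ a b, toFun a = toFun b → le a b ∨ le b a
  map_zero : toFun 0 = 0
  map_last : toFun (Fin.last (m + 1)) = Fin.last (n + 1)
  zero_le : ∀ a, toFun a = 0 → le 0 a
  le_last : ∀ a, toFun a = Fin.last (n + 1) → le a (Fin.last (m + 1))

namespace ISHom

/-- The identity morphism of `⟨n-1⟩`; its fibres have one element each. -/
def id (n : ℕ) : ISHom n n where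
  toFun := fun a => a
  le := fun a b => a = b
  eq_of_le := fun _ _ h => h
  le_refl := fun _ => rfl
  le_trans := fun _ _ _ h h' => h.trans h'
  le_antisymm := fun _ _ h _ => h
  le_total := fun _ _ h => Or.inl h
  map_zero := rfl
  map_last := rfl
  zero_le := fun _ h => h.symm
  le_last := fun _ h => h

/-- Composition (`f` first, then `g`). The fibre of the composite over `k` is the ordered sum of
the fibres of `f` over the elements of the ordered set `g⁻¹(k)`. -/
def comp {l m n : ℕ} (f : ISHom l m) (g : ISHom m n) : ISHom l n where
  toFun := fun a => g.toFun (f.toFun a)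
  le := fun a b => (f.toFun a ≠ f.toFun b ∧ g.le (f.toFun a) (f.toFun b)) ∨ f.le a b
  eq_of_le := by
    rintro a b (⟨-, h⟩ | h)
    · exact g.eq_of_le _ _ h
    · rw [f.eq_of_le _ _ h]
  le_refl := fun a => Or.inr (f.le_refl a)
  le_trans := by
    rintro a b c (⟨h1, h2⟩ | h) (⟨h3, h4⟩ | h')
    · refine Or.inl ⟨fun e => h3 ?_, g.le_trans _ _ _ h2 h4⟩
      exact g.le_antisymm _ _ h4 (e ▸ h2)
    · rw [f.eq_of_le _ _ h'] at h1 h2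
      exact Or.inl ⟨h1, h2⟩
    · rw [← f.eq_of_le _ _ h] at h3 h4
      exact Or.inl ⟨h3, h4⟩
    · exact Or.inr (f.le_trans _ _ _ h h')
  le_antisymm := by
    rintro a b (⟨h1, h2⟩ | h) (⟨h3, h4⟩ | h')
    · exact absurd (g.le_antisymm _ _ h2 h4) h1
    · exact absurd (f.eq_of_le _ _ h').symm h1
    · exact absurd (f.eq_of_le _ _ h).symm h3
    · exact f.le_antisymm _ _ h h'
  le_total := by
    intro a b h
    by_cases e : f.toFun a = f.toFun b
    · exact (f.le_total a b e).imp Or.inr Or.inr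
    · exact (g.le_total _ _ h).imp (fun h => Or.inl ⟨e, h⟩) (fun h => Or.inl ⟨fun e' => e e'.symm, h⟩)
  map_zero := by rw [f.map_zero, g.map_zero]
  map_last := by rw [f.map_last, g.map_last]
  zero_le := by
    intro a h
    by_cases e : f.toFun a = 0
    · exact Or.inr (f.zero_le a e)
    · rw [f.map_zero]
      exact Or.inl ⟨fun e' => e e'.symm, g.zero_le _ h⟩
  le_last := by
    intro a h
    by_cases e : f.toFun a = Fin.last (m + 1)
    · exact Or.inr (f.le_last a e)
    · rw [f.map_last]
      exact Or.inl ⟨e, g.le_last _ h⟩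

/-- A monotone boundary preserving map of intervals, as a morphism of `IS`: every fibre carries
the order induced from the source. -/
def ofMonotone {m n : ℕ} (f : Fin (m + 2) → Fin (n + 2)) (_hf : Monotone f) (h0 : f 0 = 0)
    (h1 : f (Fin.last (m + 1)) = Fin.last (n + 1)) : ISHom m n where
  toFun := f
  le := fun a b => f a = f b ∧ a ≤ b
  eq_of_le := fun _ _ h => h.1
  le_refl := fun a => ⟨rfl, _root_.le_refl a⟩
  le_trans := fun _ _ _ h h' => ⟨h.1.trans h'.1, h.2.trans h'.2⟩
  le_antisymm := fun _ _ h h' => _root_.le_antisymm h.2 h'.2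
  le_total := fun a b h => (_root_.le_total a b).imp (fun h' => ⟨h, h'⟩) (fun h' => ⟨h.symm, h'⟩)
  map_zero := h0
  map_last := h1
  zero_le := fun a h => ⟨h0.trans h.symm, Fin.zero_le a⟩
  le_last := fun a h => ⟨h.trans h1.symm, Fin.le_last a⟩

end ISHom

/-- The category `IS`. The object with `len = n` is the interval `⟨n-1⟩`, `n ≥ 0`. -/
structure ISCat where
  len : ℕ

instance : SmallCategory ISCat where
  Hom X Y := ISHom X.len Y.len
  id X := ISHom.id X.len
  comp f g := ISHom.comp f g
  id_comp f := by
    apply ISHom.ext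
    · rfl
    · funext a b
      refine propext ⟨?_, fun h => ?_⟩
      · rintro (⟨-, h⟩ | h)
        · exact h
        · exact (show a = b from h) ▸ f.le_refl a
      · by_cases e : a = b
        · exact Or.inr e
        · exact Or.inl ⟨e, h⟩
  comp_id f := by
    apply ISHom.ext
    · rfl
    · funext a b
      refine propext ⟨?_, fun h => Or.inr h⟩
      rintro (⟨h, h'⟩ | h)
      · exact absurd h' h
      · exact h
  assoc f g h := by
    apply ISHom.ext
    · rfl
    · funext a b
      have := congrArg (a₁ := f.toFun a) (a₂ := f.toFun b) g.toFun
      simp only [ISHom.comp, eq_iff_iff]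
      tauto

/-! ### Joyal's duality and the inclusion of the intervals in `IS` -/

/-- Joyal's dual of `φ : [m] → [n]`, a map `⟨n-1⟩ → ⟨m-1⟩`. An element `t` of
`⟨n-1⟩ = Fin (n + 2)` is viewed as the cut of `[n]` with lower part `{i | i < t}`; its image is the
cut of `[m]` whose lower part is the preimage of that lower part. In the numbering of the points
of an interval that starts with `-1`, the dual of the coface `δ i` takes the value `i - 1` twice,
and the dual of the codegeneracy `σ i` misses the value `i`. -/
def joyalDual {m n : ℕ} (φ : Fin (m + 1) →o Fin (n + 1)) (t : Fin (n + 2)) : Fin (m + 2) :=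
  ⟨(Finset.univ.filter fun i : Fin (m + 1) => (φ i : ℕ) < t).card, by
    have := Finset.card_filter_le (Finset.univ : Finset (Fin (m + 1))) fun i => (φ i : ℕ) < t
    simp only [Finset.card_univ, Fintype.card_fin] at this
    omega⟩

theorem lt_joyalDual_iff {m n : ℕ} (φ : Fin (m + 1) →o Fin (n + 1)) (t : Fin (n + 2))
    (i : Fin (m + 1)) : (i : ℕ) < joyalDual φ t ↔ (φ i : ℕ) < t := by
  set S := Finset.univ.filter fun i : Fin (m + 1) => (φ i : ℕ) < t with hS
  have hval : (joyalDual φ t : ℕ) = S.card := rfl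
  rw [hval]
  constructor
  · intro h
    by_contra hc
    have hsub : S ⊆ Finset.Iio i := by
      intro k hk
      rw [Finset.mem_Iio]
      by_contra hki
      have h1 : (φ k : ℕ) < t := (Finset.mem_filter.mp hk).2
      have h2 : (φ i : ℕ) ≤ φ k := φ.monotone (not_lt.mp hki)
      omega
    have := Finset.card_le_card hsub
    rw [Fin.card_Iio] at this
    omega
  · intro h
    have hsub : Finset.Iic i ⊆ S := by
      intro k hk
      have h2 : (φ k : ℕ) ≤ φ i := φ.monotone (Finset.mem_Iic.mp hk)
      exact Finset.mem_filter.mpr ⟨Finset.mem_univ _, by omega⟩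
    have := Finset.card_le_card hsub
    rw [Fin.card_Iic] at this
    omega

theorem fin_ext_of_lt_iff {m : ℕ} {s t : Fin (m + 2)}
    (h : ∀ i : Fin (m + 1), (i : ℕ) < s ↔ (i : ℕ) < t) : s = t := by
  apply Fin.ext
  by_contra hne
  rcases lt_or_gt_of_ne hne with hlt | hlt
  · have := (h ⟨s, by omega⟩).mpr hlt
    simp at this
  · have := (h ⟨t, by omega⟩).mp hlt
    simp at this

theorem joyalDual_mono {m n : ℕ} (φ : Fin (m + 1) →o Fin (n + 1)) : Monotone (joyalDual φ) := by
  intro s t hst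
  rw [Fin.le_def, joyalDual, joyalDual]
  dsimp only
  refine Finset.card_le_card fun i hi => ?_
  have h1 := (Finset.mem_filter.mp hi).2
  have h2 : (s : ℕ) ≤ t := hst
  exact Finset.mem_filter.mpr ⟨Finset.mem_univ _, by omega⟩

theorem joyalDual_zero {m n : ℕ} (φ : Fin (m + 1) →o Fin (n + 1)) : joyalDual φ 0 = 0 :=
  fin_ext_of_lt_iff fun i => by rw [lt_joyalDual_iff]; simp

theorem joyalDual_last {m n : ℕ} (φ : Fin (m + 1) →o Fin (n + 1)) :
    joyalDual φ (Fin.last (n + 1)) = Fin.last (m + 1) :=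
  fin_ext_of_lt_iff fun i => by
    rw [lt_joyalDual_iff]
    have := i.2
    have := (φ i).2
    simp only [Fin.val_last]
    omega

/-- The functor `Δ → ISᵒᵖ`: Joyal's duality, which identifies `Δ` with the opposite of the category
of intervals, followed by the inclusion of the category of intervals in `IS`. -/
def deltaToISOp : SimplexCategory ⥤ ISCatᵒᵖ where
  obj X := Opposite.op ⟨X.len⟩
  map {X Y} φ := Quiver.Hom.op (X := (⟨Y.len⟩ : ISCat)) (Y := ⟨X.len⟩)
    (ISHom.ofMonotone (joyalDual φ.toOrderHom) (joyalDual_mono _) (joyalDual_zero _)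
      (joyalDual_last _))
  map_id X := by
    have key : joyalDual (SimplexCategory.Hom.toOrderHom (𝟙 X)) = fun a => a := by
      funext t
      exact fin_ext_of_lt_iff fun i => by rw [lt_joyalDual_iff]; rfl
    apply Quiver.Hom.unop_inj
    apply ISHom.ext
    · exact key
    · funext a b
      refine propext ⟨fun h => ?_, fun h => ?_⟩
      · have h1 := h.1
        rw [key] at h1
        exact h1
      · obtain rfl : a = b := h
        exact ⟨rfl, le_refl a⟩
  map_comp {X Y Z} φ ψ := by
    have key : ∀ t, joyalDual (SimplexCategory.Hom.toOrderHom (φ ≫ ψ)) t =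
        joyalDual φ.toOrderHom (joyalDual ψ.toOrderHom t) := by
      intro t
      refine fin_ext_of_lt_iff fun i => ?_
      rw [lt_joyalDual_iff, lt_joyalDual_iff, lt_joyalDual_iff]
      rfl
    apply Quiver.Hom.unop_inj
    apply ISHom.ext
    · funext t
      exact key t
    · funext a b
      refine propext ⟨fun h => ?_, fun h => ?_⟩
      · have h1 := h.1
        rw [key, key] at h1
        by_cases e : joyalDual ψ.toOrderHom a = joyalDual ψ.toOrderHom b
        · exact Or.inr ⟨e, h.2⟩
        · exact Or.inl ⟨e, h1, joyalDual_mono _ h.2⟩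
      · rcases h with ⟨h1, h2, h3⟩ | ⟨h1, h2⟩
        · refine ⟨(key a).trans (h2.trans (key b).symm), ?_⟩
          by_contra hab
          exact h1 (le_antisymm h3 (joyalDual_mono _ (le_of_not_ge hab)))
        · refine ⟨?_, h2⟩
          change joyalDual _ a = joyalDual _ b
          rw [key, key]
          exact congrArg _ h1

/-! ### Chain complexes and free `𝒮`-objects -/

/-- `ℤ`-graded chain complexes of abelian groups. -/
abbrev Chain : Type (u + 1) := ChainComplex (ModuleCat.{u} ℤ) ℤ

/-- Cosimplicial chain complexes. -/
abbrev CosimpChain : Type (u + 1) := SimplexCategory ⥤ Chain.{u}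

/-- The restriction functor from `𝒮`-chain complexes, that is functors `ISᵒᵖ → Chain`, to
cosimplicial chain complexes. -/
abbrev restrictS : (ISCatᵒᵖ ⥤ Chain.{u}) ⥤ CosimpChain.{u} :=
  (Functor.whiskeringLeft SimplexCategory ISCatᵒᵖ Chain.{u}).obj deltaToISOp

/-- The free `𝒮`-object functor: the left adjoint of the restriction functor. -/
noncomputable def freeS : CosimpChain.{u} ⥤ (ISCatᵒᵖ ⥤ Chain.{u}) :=
  deltaToISOp.lan

/-- The adjunction that characterizes `freeS`. -/
noncomputable def freeSAdjunction : freeS.{u} ⊣ restrictS.{u} :=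
  deltaToISOp.lanAdjunction Chain.{u}

/-! ### The total complex of a cosimplicial chain complex -/

/-- The bidegrees `(n, k)` with `n - k = m`. -/
abbrev Bideg (m : ℤ) : Type := {p : ℕ × ℤ // (p.1 : ℤ) - p.2 = m}

/-- The term of degree `m` of the total complex: the product of the `C^n_k` over `n - k = m`. -/
abbrev TotX (C : CosimpChain.{u}) (m : ℤ) : Type u :=
  ∀ p : Bideg m, (C.obj (SimplexCategory.mk p.1.1)).X p.1.2

/-- The alternating sum of cofaces `∑ i, (-1) ^ i • d_i : C^n → C^(n+1)`, `0 ≤ i ≤ n + 1`. -/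
def cofaceSum (C : CosimpChain.{u}) (n : ℕ) :
    C.obj (SimplexCategory.mk n) ⟶ C.obj (SimplexCategory.mk (n + 1)) :=
  ∑ i : Fin (n + 2), (-1 : ℤ) ^ (i : ℕ) • C.map (SimplexCategory.δ i)

/-- The horizontal differential `d : C^n_k → C^(n+1)_k`: the alternating sum of the cofaces times
the sign `(-1) ^ k`. With this sign it anticommutes with the vertical differential. -/
def horizontalD (C : CosimpChain.{u}) (n : ℕ) (k : ℤ) :
    (C.obj (SimplexCategory.mk n)).X k →ₗ[ℤ] (C.obj (SimplexCategory.mk (n + 1))).X k :=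
  ((k.negOnePow : ℤˣ) : ℤ) • ((cofaceSum C n).f k).hom

theorem horizontalD_apply (C : CosimpChain.{u}) (n : ℕ) (k : ℤ)
    (x : (C.obj (SimplexCategory.mk n)).X k) :
    horizontalD C n k x = ((k.negOnePow : ℤˣ) : ℤ) • ((cofaceSum C n).f k).hom x := rfl

/-- The vertical differential `∂ : C^n_(k+1) → C^n_k`. -/
def verticalD (C : CosimpChain.{u}) (n : ℕ) (k : ℤ) :
    (C.obj (SimplexCategory.mk n)).X (k + 1) →ₗ[ℤ] (C.obj (SimplexCategory.mk n)).X k :=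
  ((C.obj (SimplexCategory.mk n)).d (k + 1) k).hom

/-- The components of the total differential:
`(a⁰, a¹, a², …) ↦ (-∂ a⁰, d a⁰ - ∂ a¹, d a¹ - ∂ a², …)`. -/
def totDFun (C : CosimpChain.{u}) (m : ℤ) (a : TotX C m) : TotX C (m + 1)
  | ⟨(0, k), h⟩ => - verticalD C 0 k (a ⟨(0, k + 1), by dsimp only at h ⊢; omega⟩)
  | ⟨(n + 1, k), h⟩ =>
      horizontalD C n k (a ⟨(n, k), by dsimp only at h ⊢; push_cast at h; omega⟩)
        - verticalD C (n + 1) k (a ⟨(n + 1, k + 1), by dsimp only at h ⊢; omega⟩)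

def totD (C : CosimpChain.{u}) (m : ℤ) : TotX C m →ₗ[ℤ] TotX C (m + 1) where
  toFun := totDFun C m
  map_add' a b := by
    funext ⟨⟨n, k⟩, h⟩
    cases n <;> simp [totDFun] <;> abel
  map_smul' c a := by
    funext ⟨⟨n, k⟩, h⟩
    cases n
    · simp [totDFun]
    · simp [totDFun, zsmul_sub]

theorem verticalD_verticalD (C : CosimpChain.{u}) (n : ℕ) (k : ℤ)
    (x : (C.obj (SimplexCategory.mk n)).X (k + 1 + 1)) :
    verticalD C n k (verticalD C n (k + 1) x) = 0 := by
  have h := (C.obj (SimplexCategory.mk n)).d_comp_d (k + 1 + 1) (k + 1) k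
  exact congrArg (fun f => f.hom x) h

theorem verticalD_horizontalD (C : CosimpChain.{u}) (n : ℕ) (k : ℤ)
    (x : (C.obj (SimplexCategory.mk n)).X (k + 1)) :
    verticalD C (n + 1) k (horizontalD C n (k + 1) x) = - horizontalD C n k (verticalD C n k x) := by
  have h : verticalD C (n + 1) k (((cofaceSum C n).f (k + 1)).hom x) =
      ((cofaceSum C n).f k).hom (verticalD C n k x) :=
    congrArg (fun f => f.hom x) ((cofaceSum C n).comm (k + 1) k)
  rw [horizontalD_apply, horizontalD_apply, map_zsmul, h,
    Int.negOnePow_succ, Units.val_neg, neg_zsmul]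

theorem horizontalD_horizontalD (C : CosimpChain.{u}) (n : ℕ) (k : ℤ)
    (x : (C.obj (SimplexCategory.mk n)).X k) :
    horizontalD C (n + 1) k (horizontalD C n k x) = 0 := by
  have h0 : cofaceSum C n ≫ cofaceSum C (n + 1) = 0 :=
    AlgebraicTopology.AlternatingCofaceMapComplex.d_squared (C := Chain.{u}) C n
  have h : ((cofaceSum C (n + 1)).f k).hom (((cofaceSum C n).f k).hom x) = 0 :=
    congrArg (fun f => (f.f k).hom x) h0
  rw [horizontalD_apply, horizontalD_apply, map_zsmul, h,
    zsmul_zero, zsmul_zero]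

/-- A cosimplicial map commutes with the horizontal differentials. -/
theorem horizontalD_naturality {C D : CosimpChain.{u}} (φ : C ⟶ D) (n : ℕ) (k : ℤ)
    (x : (C.obj (SimplexCategory.mk n)).X k) :
    ((φ.app (SimplexCategory.mk (n + 1))).f k).hom (horizontalD C n k x) =
      horizontalD D n k (((φ.app (SimplexCategory.mk n)).f k).hom x) := by
  have h0 : cofaceSum C n ≫ φ.app (SimplexCategory.mk (n + 1)) =
      φ.app (SimplexCategory.mk n) ≫ cofaceSum D n := by
    rw [cofaceSum, cofaceSum, Preadditive.sum_comp, Preadditive.comp_sum]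
    refine Finset.sum_congr rfl fun i _ => ?_
    rw [Preadditive.zsmul_comp, Preadditive.comp_zsmul, φ.naturality]
  have h : ((φ.app (SimplexCategory.mk (n + 1))).f k).hom (((cofaceSum C n).f k).hom x) =
      ((cofaceSum D n).f k).hom (((φ.app (SimplexCategory.mk n)).f k).hom x) :=
    congrArg (fun f => (f.f k).hom x) h0
  rw [horizontalD_apply, horizontalD_apply, map_zsmul, h]

/-- A cosimplicial map commutes with the vertical differentials. -/
theorem verticalD_naturality {C D : CosimpChain.{u}} (φ : C ⟶ D) (n : ℕ) (k : ℤ)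
    (x : (C.obj (SimplexCategory.mk n)).X (k + 1)) :
    ((φ.app (SimplexCategory.mk n)).f k).hom (verticalD C n k x) =
      verticalD D n k (((φ.app (SimplexCategory.mk n)).f (k + 1)).hom x) :=
  (congrArg (fun f => f.hom x) ((φ.app (SimplexCategory.mk n)).comm (k + 1) k)).symm

theorem totD_totD (C : CosimpChain.{u}) (m : ℤ) (a : TotX C m) :
    totD C (m + 1) (totD C m a) = 0 := by
  funext ⟨⟨n, k⟩, h⟩
  match n, h with
  | 0, h => simp [totD, totDFun, verticalD_verticalD]
  | 1, h => simp [totD, totDFun, verticalD_verticalD, verticalD_horizontalD]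
  | n + 2, h =>
    simp [totD, totDFun, verticalD_verticalD, verticalD_horizontalD, horizontalD_horizontalD]

/-- The map induced by a cosimplicial map on the terms of degree `m` of the total complexes. -/
def totMap {C D : CosimpChain.{u}} (φ : C ⟶ D) (m : ℤ) : TotX C m →ₗ[ℤ] TotX D m where
  toFun a := fun p => ((φ.app (SimplexCategory.mk p.1.1)).f p.1.2).hom (a p)
  map_add' a b := by
    funext p
    simp
  map_smul' c a := by
    funext p
    simp

theorem totMap_totD {C D : CosimpChain.{u}} (φ : C ⟶ D) (m : ℤ) (a : TotX C m) :
    totMap φ (m + 1) (totD C m a) = totD D m (totMap φ m a) := by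
  funext ⟨⟨n, k⟩, h⟩
  match n, h with
  | 0, h =>
    change ((φ.app (SimplexCategory.mk 0)).f k).hom (- verticalD C 0 k _) = - verticalD D 0 k _
    rw [map_neg, verticalD_naturality]
    rfl
  | n + 1, h =>
    change ((φ.app (SimplexCategory.mk (n + 1))).f k).hom
      (horizontalD C n k _ - verticalD C (n + 1) k _) =
        horizontalD D n k _ - verticalD D (n + 1) k _
    rw [map_sub, verticalD_naturality, horizontalD_naturality]
    rfl

/-- The total complex (formed with direct products) of a cosimplicial chain complex, a cochain
complex of abelian groups, as a functor. -/
def totFunctor : CosimpChain.{u} ⥤ CochainComplex (ModuleCat.{u} ℤ) ℤ where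
  obj C := CochainComplex.of (fun m => ModuleCat.of ℤ (TotX C m))
    (fun m => ModuleCat.ofHom (totD C m)) (fun m => by
      apply ModuleCat.hom_ext
      exact LinearMap.ext (totD_totD C m))
  map φ := CochainComplex.ofHom (fun m => ModuleCat.ofHom (totMap φ m)) (fun m => by
      simp only [CochainComplex.of_d]
      apply ModuleCat.hom_ext
      exact LinearMap.ext fun a => (totMap_totD φ m a).symm)
  map_id C := by
    ext m a
    rfl
  map_comp φ ψ := by
    ext m a
    rfl

/-! ### The theorem's hypotheses and conclusion -/

/-- Cosimplicial chain complexes all of whose components `C^n_k` are finitely generated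
torsion-free abelian groups. -/
def HasFGTorsionFreeComponents : ObjectProperty (CosimpChain.{u}) := fun C =>
  ∀ (n : ℕ) (k : ℤ), Module.Finite ℤ ((C.obj (SimplexCategory.mk n)).X k) ∧
    Module.IsTorsionFree ℤ ((C.obj (SimplexCategory.mk n)).X k)

/-- A natural homotopy between two natural transformations of functors with values in cochain
complexes: a cochain homotopy for each object, natural in the object. -/
structure NatHomotopy {D : Type v} [Category.{w} D] {F G : D ⥤ CochainComplex (ModuleCat.{u} ℤ) ℤ}
    (α β : F ⟶ G) where
  homotopy : ∀ X : D, Homotopy (α.app X) (β.app X)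
  naturality : ∀ {X Y : D} (φ : X ⟶ Y) (i j : ℤ),
    (F.map φ).f i ≫ (homotopy Y).hom i j = (homotopy X).hom i j ≫ (G.map φ).f j

/-- A natural cochain homotopy equivalence between two functors with values in cochain complexes:
natural cochain maps in both directions, with natural homotopies from their composites to the
identities. -/
structure NatHomotopyEquiv {D : Type v} [Category.{w} D]
    (F G : D ⥤ CochainComplex (ModuleCat.{u} ℤ) ℤ) where
  hom : F ⟶ G
  inv : G ⟶ F
  homotopyHomInvId : NatHomotopy (hom ≫ inv) (𝟙 F)
  homotopyInvHomId : NatHomotopy (inv ≫ hom) (𝟙 G)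

/-!
A morphism of `IS` factors uniquely as a permutation of the inner points followed by a monotone map.
Hence, in cosimplicial degree `n`, the free `𝒮`-object `F_𝒮(C)` is a direct sum of copies of `C^n`
indexed by the permutations of `n` letters, and the unit `ι` includes the summand of the identity.
A coface `d_i` of `F_𝒮(C)` doubles the point `i` of the permutation, so it preserves the summands of
the identity permutations and the complementary summands. Hence the projection `r` to the summand of
the identity commutes with the alternating sums of the cofaces, and `r ι = 1`. It remains to
contract the complementary summands naturally.

The permutation part of a morphism `f` is encoded by the lexicographic total order
`ISHom.Precedes f` on its source. Let `t` be the length of the longest initial segment on which this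
order is the natural one and which is also initial for it (`ISHom.prefixLen`). Then `d_i` increases
`t` by one if `i < t` and preserves it if `i ≥ t` (`ISHom.prefixLen_δ_comp`). On the summands with a
given `t` the cofaces `d_0, …, d_{t-1}` thus behave like the cofaces of a cosimplicial object whose
last coface has been omitted, and the degeneracy `(-1)^t s_{t-2}` (zero if `t = 1`) is a contracting
homotopy: `s_{t-1} d_{t-1} = 1`, and all the other terms of `d h + h d` cancel by the cosimplicial
identities (`sum_δ_signedσ`). The identity permutation, where `t = n + 2`, has to be excluded,
because there the needed degeneracy `s_{n+1}` of `F_𝒮(C)^{n+1}` does not exist.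

The maps `r` and `h` are defined through the universal property of the pointwise Kan extension
(`freeSDesc`), that is, on the generators given by morphisms of `IS`. They consist of chain maps
natural in `C`, so they induce, with the sign `(-1)^k` on `h`, a natural cochain map and a natural
homotopy of total complexes (`totHomOf`, `totHomotopy`).
-/

/-! ### The total order of a morphism of `IS` -/

namespace ISHom

/-- The lexicographic total order on the source of a morphism of `IS`: first compare the images,
then use the order of the common fibre. -/
def Precedes {m n : ℕ} (f : ISHom m n) (a b : Fin (m + 2)) : Prop :=
  f.toFun a < f.toFun b ∨ f.le a b

/-- The point `a` precedes, for the total order of `f`, all the points that follow it in the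
natural order. -/
def InOrder {m n : ℕ} (f : ISHom m n) (a : Fin (m + 2)) : Prop :=
  ∀ b, a < b → f.Precedes a b

/-- Composing with a monotone map on the target side does not change the total order: the total
order is the permutation part of the factorization of `f` into a permutation and a monotone map. -/
theorem precedes_comp_ofMonotone {l m n : ℕ} (f : ISHom l m) (e : Fin (m + 2) → Fin (n + 2))
    (he : Monotone e) (h0 : e 0 = 0) (h1 : e (Fin.last (m + 1)) = Fin.last (n + 1))
    (a b : Fin (l + 2)) :
    (f.comp (ofMonotone e he h0 h1)).Precedes a b ↔ f.Precedes a b := by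
  simp only [Precedes, comp, ofMonotone]
  constructor
  · rintro (h | ⟨h, -, h'⟩ | h)
    · exact Or.inl (he.reflect_lt h)
    · exact Or.inl (lt_of_le_of_ne h' h)
    · exact Or.inr h
  · rintro (h | h)
    · rcases (he h.le).lt_or_eq with h' | h'
      · exact Or.inl h'
      · exact Or.inr (Or.inl ⟨h.ne, h', h.le⟩)
    · exact Or.inr (Or.inr h)

theorem inOrder_ofMonotone_comp {l m n : ℕ} (e : Fin (l + 2) → Fin (m + 2))
    (he : Monotone e) (h0 : e 0 = 0) (h1 : e (Fin.last (l + 1)) = Fin.last (m + 1))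
    (hs : Function.Surjective e) (f : ISHom m n) (a : Fin (l + 2)) :
    ((ofMonotone e he h0 h1).comp f).InOrder a ↔ f.InOrder (e a) := by
  simp only [InOrder, Precedes, comp, ofMonotone]
  constructor
  · intro h c hc
    obtain ⟨b, rfl⟩ := hs c
    rcases h b (he.reflect_lt hc) with h | ⟨-, h⟩ | h
    · exact Or.inl h
    · exact Or.inr h
    · exact absurd h.1 hc.ne
  · intro h b hb
    rcases (he hb.le).lt_or_eq with h' | h'
    · exact (h _ h').imp_right fun h => Or.inl ⟨h'.ne, h⟩
    · exact Or.inr (Or.inr ⟨h', hb.le⟩)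

theorem inOrder_zero {m n : ℕ} (f : ISHom m n) : f.InOrder 0 := by
  intro b _
  by_cases h : f.toFun b = 0
  · exact Or.inr (f.zero_le b h)
  · exact Or.inl (by rw [f.map_zero]; exact Fin.pos_of_ne_zero h)

theorem inOrder_last {m n : ℕ} (f : ISHom m n) : f.InOrder (Fin.last (m + 1)) :=
  fun b hb => absurd hb (Fin.le_last b).not_gt

open Classical in
/-- The length of the longest initial segment of `Fin (m + 2)` in the natural order on which the
total order of `f` agrees with the natural order and which is also an initial segment for the total
order of `f`. It is the first point which does not satisfy `InOrder`, or `m + 2` if all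
points do. -/
noncomputable def prefixLen {m n : ℕ} (f : ISHom m n) : ℕ :=
  Nat.find (p := fun a => ∀ h : a < m + 2, ¬ f.InOrder ⟨a, h⟩)
    ⟨m + 2, fun h => absurd h (lt_irrefl _)⟩

theorem prefixLen_eq_iff {m n : ℕ} (f : ISHom m n) (t : ℕ) :
    f.prefixLen = t ↔ (∀ h : t < m + 2, ¬ f.InOrder ⟨t, h⟩) ∧
      ∀ a < t, ∃ h : a < m + 2, f.InOrder ⟨a, h⟩ := by
  classical
  simp only [prefixLen, Nat.find_eq_iff, not_forall, not_not]

theorem prefixLen_congr {m n n' : ℕ} (f : ISHom m n) (g : ISHom m n')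
    (h : ∀ a, f.InOrder a ↔ g.InOrder a) : f.prefixLen = g.prefixLen := by
  rw [prefixLen_eq_iff]
  simpa only [h] using (prefixLen_eq_iff g _).1 rfl

theorem prefixLen_comp_ofMonotone {l m n : ℕ} (f : ISHom l m) (e : Fin (m + 2) → Fin (n + 2))
    (he : Monotone e) (h0 : e 0 = 0) (h1 : e (Fin.last (m + 1)) = Fin.last (n + 1)) :
    (f.comp (ofMonotone e he h0 h1)).prefixLen = f.prefixLen :=
  prefixLen_congr _ _ fun _ => forall₂_congr fun _ _ => precedes_comp_ofMonotone f e he h0 h1 _ _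

theorem one_le_prefixLen {m n : ℕ} (f : ISHom m n) : 1 ≤ f.prefixLen := by
  by_contra h
  exact ((prefixLen_eq_iff f 0).1 (by omega)).1 (by omega) f.inOrder_zero

theorem prefixLen_le {m n : ℕ} (f : ISHom m n) : f.prefixLen ≤ m + 2 := by
  by_contra h
  obtain ⟨h', -⟩ := ((prefixLen_eq_iff f _).1 rfl).2 (m + 2) (by omega)
  omega

theorem prefixLen_eq_add_two_iff {m n : ℕ} (f : ISHom m n) :
    f.prefixLen = m + 2 ↔ ∀ a, f.InOrder a := by
  rw [prefixLen_eq_iff]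
  constructor
  · exact fun h a => (h.2 a a.2).2
  · exact fun h => ⟨fun h' => absurd h' (lt_irrefl _), fun a ha => ⟨ha, h _⟩⟩

theorem prefixLen_eq_two {n : ℕ} (f : ISHom 0 n) : f.prefixLen = 2 :=
  (prefixLen_eq_add_two_iff f).2 fun a => by
    fin_cases a
    exacts [f.inOrder_zero, f.inOrder_last]

/-- The total order of `f` is the natural order if and only if `f` is monotone and all fibres carry
the natural order. -/
theorem exists_eq_ofMonotone {m n : ℕ} (f : ISHom m n) (h : ∀ a, f.InOrder a) :
    ∃ he : Monotone f.toFun, f = ofMonotone f.toFun he f.map_zero f.map_last := by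
  refine ⟨fun a b hab => ?_, ?_⟩
  · rcases hab.lt_or_eq with hab | rfl
    · exact (h a b hab).elim (fun h => h.le) fun h => (f.eq_of_le _ _ h).le
    · exact le_rfl
  · refine ISHom.ext rfl ?_
    funext a b
    refine propext ⟨fun hab => ⟨f.eq_of_le _ _ hab, ?_⟩, fun ⟨hab, hab'⟩ => ?_⟩
    · by_contra hba
      rcases h b a (not_le.1 hba) with h' | h'
      · exact h'.ne (f.eq_of_le _ _ hab).symm
      · exact hba (f.le_antisymm _ _ hab h').le
    · rcases hab'.lt_or_eq with hlt | rfl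
      · exact (h a b hlt).resolve_left fun h' => h'.ne hab
      · exact f.le_refl a

theorem inOrder_ofMonotone {m n : ℕ} (e : Fin (m + 2) → Fin (n + 2))
    (he : Monotone e) (h0 : e 0 = 0) (h1 : e (Fin.last (m + 1)) = Fin.last (n + 1))
    (a : Fin (m + 2)) : (ofMonotone e he h0 h1).InOrder a := fun _ hb =>
  (he hb.le).lt_or_eq.imp_right fun h => ⟨h, hb.le⟩

end ISHom

/-! ### Joyal duality -/

theorem joyalDual_surjective {m n : ℕ} (e : Fin (n + 2) → Fin (m + 2)) (he : Monotone e)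
    (h0 : e 0 = 0) (h1 : e (Fin.last (n + 1)) = Fin.last (m + 1)) :
    ∃ φ : Fin (m + 1) →o Fin (n + 1), joyalDual φ = e := by
  classical
  -- `φ i` is the greatest `s` with `e s ≤ i`; the least `t` with `i < e t` is its successor.
  have key : ∀ i : Fin (m + 1), ∃ s : Fin (n + 1), ∀ t : Fin (n + 2),
      (s : ℕ) < t ↔ (i : ℕ) < e t := by
    intro i
    have hex : ∃ t : ℕ, ∃ h : t < n + 2, (i : ℕ) < e ⟨t, h⟩ :=
      ⟨n + 1, by omega, by
        have : e ⟨n + 1, by omega⟩ = Fin.last (m + 1) := h1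
        rw [this]; exact i.2⟩
    obtain ⟨h2, h3⟩ := Nat.find_spec hex
    have hpos : Nat.find hex ≠ 0 := by
      intro h
      have h4 : (⟨Nat.find hex, h2⟩ : Fin (n + 2)) = 0 := Fin.ext h
      rw [h4, h0] at h3
      simp at h3
    refine ⟨⟨Nat.find hex - 1, by omega⟩, fun t => ⟨fun h => ?_, fun h => ?_⟩⟩
    · have h5 : (⟨Nat.find hex, h2⟩ : Fin (n + 2)) ≤ t := by
        rw [Fin.le_def]; dsimp only at h ⊢; omega
      have := he h5
      rw [Fin.le_def] at this
      omega
    · have := Nat.find_min' hex ⟨t.2, h⟩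
      dsimp only
      omega
  choose φ hφ using key
  refine ⟨⟨φ, fun i j hij => ?_⟩, ?_⟩
  · by_contra h
    rw [not_le, Fin.lt_def] at h
    have h6 := (hφ j (φ i).castSucc).1 h
    have h7 : ¬ ((φ i : ℕ) < (φ i).castSucc) := lt_irrefl _
    rw [hφ] at h7
    rw [Fin.le_def] at hij
    omega
  · funext t
    exact fin_ext_of_lt_iff fun i => by rw [lt_joyalDual_iff]; exact hφ i t

theorem joyalDual_injective {m n : ℕ} :
    Function.Injective (joyalDual : (Fin (m + 1) →o Fin (n + 1)) → Fin (n + 2) → Fin (m + 2)) := by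
  intro φ ψ h
  ext i
  have h' : ∀ t : Fin (n + 2), (φ i : ℕ) < t ↔ (ψ i : ℕ) < t := fun t => by
    rw [← lt_joyalDual_iff, ← lt_joyalDual_iff, h]
  have h1 := h' (φ i).castSucc
  have h2 := h' (ψ i).castSucc
  simp only [Fin.val_castSucc] at h1 h2
  omega

theorem joyalDual_δ {n : ℕ} (i : Fin (n + 2)) (a : Fin (n + 3)) :
    (joyalDual (SimplexCategory.δ i).toOrderHom a : ℕ) =
      if (a : ℕ) ≤ i then (a : ℕ) else a - 1 := by
  have : joyalDual (SimplexCategory.δ i).toOrderHom a =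
      (⟨if (a : ℕ) ≤ i then (a : ℕ) else a - 1, by split_ifs <;> omega⟩ : Fin (n + 2)) := by
    refine fin_ext_of_lt_iff fun j => ?_
    rw [lt_joyalDual_iff]
    change ((i.succAbove j : Fin (n + 2)) : ℕ) < a ↔ _
    simp only [Fin.succAbove, Fin.lt_def, Fin.val_castSucc]
    split_ifs <;> simp only [Fin.val_castSucc, Fin.val_succ] <;> omega
  rw [this]

theorem joyalDual_δ_surjective {n : ℕ} (i : Fin (n + 2)) :
    Function.Surjective (joyalDual (SimplexCategory.δ i).toOrderHom :
      Fin (n + 3) → Fin (n + 2)) := by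
  intro c
  refine ⟨⟨if (c : ℕ) ≤ i then c else c + 1, by split_ifs <;> omega⟩, Fin.ext ?_⟩
  rw [joyalDual_δ]
  dsimp only
  split_ifs <;> omega

/-- The dual of the coface `δ i` doubles the point `i`. Hence precomposing with it lengthens the
ordered initial segment by one if `i` belongs to it, and does not change its length otherwise. -/
theorem ISHom.prefixLen_δ_comp {n m : ℕ} (i : Fin (n + 2)) (f : ISHom n m)
    (he : Monotone (joyalDual (SimplexCategory.δ i).toOrderHom))
    (h0 : joyalDual (SimplexCategory.δ i).toOrderHom 0 = 0)
    (h1 : joyalDual (SimplexCategory.δ i).toOrderHom (Fin.last (n + 2)) = Fin.last (n + 1)) :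
    ((ISHom.ofMonotone (joyalDual (SimplexCategory.δ i).toOrderHom : Fin (n + 3) → Fin (n + 2))
      he h0 h1).comp f).prefixLen =
      if (i : ℕ) < f.prefixLen then f.prefixLen + 1 else f.prefixLen := by
  obtain ⟨h2, h3⟩ := (ISHom.prefixLen_eq_iff f _).1 rfl
  have hle := f.prefixLen_le
  set t := f.prefixLen
  rw [ISHom.prefixLen_eq_iff]
  simp only [ISHom.inOrder_ofMonotone_comp _ _ _ _ (joyalDual_δ_surjective i)]
  have hval : ∀ a (h : a < n + 3) (h' : (if a ≤ (i : ℕ) then a else a - 1) < n + 2),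
      (joyalDual (SimplexCategory.δ i).toOrderHom : Fin (n + 3) → Fin (n + 2)) ⟨a, h⟩ =
        ⟨if a ≤ (i : ℕ) then a else a - 1, h'⟩ := fun a h h' => Fin.ext (joyalDual_δ i ⟨a, h⟩)
  constructor
  · intro h
    have h4 : (if (if (i : ℕ) < t then t + 1 else t) ≤ (i : ℕ) then
        (if (i : ℕ) < t then t + 1 else t) else (if (i : ℕ) < t then t + 1 else t) - 1) = t := by
      split_ifs <;> omega
    have hlt : t < n + 2 := by split_ifs at h <;> omega
    rw [hval _ h (by omega)]
    simp only [h4]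
    exact h2 hlt
  · intro a ha
    have h5 : a < n + 3 := by split_ifs at ha <;> omega
    have h6 : (if a ≤ (i : ℕ) then a else a - 1) < t := by split_ifs at ha ⊢ <;> omega
    obtain ⟨h7, h8⟩ := h3 _ h6
    exact ⟨h5, by rw [hval _ h5 h7]; exact h8⟩

/-! ### The contraction of a cosimplicial object -/

section Contraction

variable {A : Type*} [Category A] [Preadditive A] (G : SimplexCategory ⥤ A)

/-- The signed codegeneracy `(-1)^t s_(t-2) : G^(n+1) → G^n` if `2 ≤ t ≤ n + 2`, and zero for the
other `t`. -/
def signedσ (n t : ℕ) : G.obj (SimplexCategory.mk (n + 1)) ⟶ G.obj (SimplexCategory.mk n) :=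
  if h : 2 ≤ t ∧ t ≤ n + 2 then
    (-1 : ℤ) ^ t • G.map (SimplexCategory.σ (⟨t - 2, by omega⟩ : Fin (n + 1)))
  else 0

theorem signedσ_add_two (n s : ℕ) (h : s < n + 1) :
    signedσ G n (s + 2) = (-1 : ℤ) ^ s • G.map (SimplexCategory.σ (⟨s, h⟩ : Fin (n + 1))) := by
  rw [signedσ, dif_pos (by omega), pow_add]
  simp

theorem signedσ_of_lt (n t : ℕ) (h : n + 2 < t) : signedσ G n t = 0 :=
  dif_neg (by omega)

theorem signedσ_one (n : ℕ) : signedσ G n 1 = 0 :=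
  dif_neg (by omega)

/-- A truncated cosimplicial identity: the cofaces with index below `t = r + 1` are contracted by
the codegeneracy `s_r`, the last of them giving the identity; the cofaces with index at least `t`
commute with `s_(r-1)`. -/
theorem sum_δ_signedσ (n t : ℕ) (ht : 1 ≤ t) (ht' : t ≤ n + 2) :
    ∑ i : Fin (n + 3), (-1 : ℤ) ^ (i : ℕ) • G.map (SimplexCategory.δ i) ≫
        signedσ G (n + 1) (if (i : ℕ) < t then t + 1 else t) +
      signedσ G n t ≫ ∑ i : Fin (n + 2), (-1 : ℤ) ^ (i : ℕ) • G.map (SimplexCategory.δ i) =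
    𝟙 _ := by
  obtain ⟨r, rfl⟩ : ∃ r, t = r + 1 := ⟨t - 1, by omega⟩
  rw [Fin.sum_univ_succAbove _ (⟨r, by omega⟩ : Fin (n + 3)), Preadditive.comp_sum, add_assoc,
    ← Finset.sum_add_distrib, Finset.sum_eq_zero, add_zero]
  · dsimp only
    rw [if_pos (by omega), signedσ_add_two G (n + 1) r (by omega), Preadditive.comp_zsmul,
      smul_smul, ← G.map_comp]
    have := SimplexCategory.δ_comp_σ_self (n := n + 1) (i := ⟨r, by omega⟩)
    simp only [Fin.castSucc_mk] at this
    rw [this, G.map_id, ← mul_pow]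
    simp
  · intro j _
    by_cases hj : (j : ℕ) < r
    · obtain ⟨s, rfl⟩ : ∃ s, r = s + 1 := ⟨r - 1, by omega⟩
      rw [Fin.succAbove_of_castSucc_lt _ _ (by rw [Fin.lt_def]; exact hj), Fin.val_castSucc,
        if_pos (by omega), signedσ_add_two G (n + 1) (s + 1) (by omega),
        signedσ_add_two G n s (by omega), Preadditive.comp_zsmul, Preadditive.comp_zsmul,
        Preadditive.zsmul_comp, ← G.map_comp, ← G.map_comp]
      have := SimplexCategory.δ_comp_σ_of_le (n := n) (i := j) (j := ⟨s, by omega⟩)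
        (by rw [Fin.le_def]; dsimp; omega)
      simp only [Fin.succ_mk] at this
      rw [this, smul_smul, smul_smul, ← add_smul]
      convert zero_smul ℤ _ using 2
      ring
    · rw [Fin.succAbove_of_le_castSucc _ _ (by rw [Fin.le_def]; exact not_lt.1 hj), Fin.val_succ,
        if_neg (by omega)]
      rcases r with _ | s
      · rw [signedσ_one, signedσ_one, Limits.comp_zero, Limits.zero_comp, smul_zero, add_zero]
      · rw [signedσ_add_two G (n + 1) s (by omega),
          signedσ_add_two G n s (by omega), Preadditive.comp_zsmul, Preadditive.comp_zsmul,
          Preadditive.zsmul_comp, ← G.map_comp, ← G.map_comp]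
        have := SimplexCategory.δ_comp_σ_of_gt (n := n) (i := j) (j := ⟨s, by omega⟩)
          (by rw [Fin.lt_def]; dsimp; omega)
        simp only [Fin.castSucc_mk] at this
        rw [this, smul_smul, smul_smul, ← add_smul]
        convert zero_smul ℤ _ using 2
        ring

end Contraction

/-! ### Maps out of the free `𝒮`-object -/

/-- The canonical map `C^m → F_𝒮(C)(Y)` indexed by a morphism from `Y` to `⟨m-1⟩` in `IS`. -/
noncomputable def freeSι (C : CosimpChain.{u}) {X : SimplexCategory} {Y : ISCatᵒᵖ}
    (g : deltaToISOp.obj X ⟶ Y) : C.obj X ⟶ (freeS.obj C).obj Y :=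
  (freeSAdjunction.unit.app C).app X ≫ (freeS.obj C).map g

theorem freeSι_map (C : CosimpChain.{u}) {X : SimplexCategory} {Y Y' : ISCatᵒᵖ}
    (g : deltaToISOp.obj X ⟶ Y) (y : Y ⟶ Y') :
    freeSι C g ≫ (freeS.obj C).map y = freeSι C (g ≫ y) := by
  simp only [freeSι, Category.assoc, Functor.map_comp]

theorem map_freeSι (C : CosimpChain.{u}) {X X' : SimplexCategory} {Y : ISCatᵒᵖ} (φ : X ⟶ X')
    (g : deltaToISOp.obj X' ⟶ Y) :
    C.map φ ≫ freeSι C g = freeSι C (deltaToISOp.map φ ≫ g) := by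
  have h := (freeSAdjunction.unit.app C).naturality φ
  simp only [freeSι, Functor.map_comp, ← Category.assoc]
  congr 1

theorem freeSι_naturality {C D : CosimpChain.{u}} (α : C ⟶ D) {X : SimplexCategory} {Y : ISCatᵒᵖ}
    (g : deltaToISOp.obj X ⟶ Y) :
    freeSι C g ≫ (freeS.map α).app Y = α.app X ≫ freeSι D g := by
  have h := congrArg (fun β => NatTrans.app β X) (freeSAdjunction.unit.naturality α)
  dsimp at h
  simp only [freeSι, Category.assoc, NatTrans.naturality, reassoc_of% h]

/-- `F_𝒮(C)(Y)` is the colimit of the `C^m` over the morphisms from `Y` to `⟨m-1⟩` in `IS`. -/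
noncomputable def freeSIsColimit (C : CosimpChain.{u}) :
    (Functor.LeftExtension.mk (freeS.obj C)
      (freeSAdjunction.unit.app C)).IsPointwiseLeftKanExtension :=
  Functor.isPointwiseLeftKanExtensionLeftKanExtensionUnit deltaToISOp C

theorem freeS_hom_ext (C : CosimpChain.{u}) {Y : ISCatᵒᵖ} {Z : Chain.{u}}
    {a b : (freeS.obj C).obj Y ⟶ Z}
    (h : ∀ (X : SimplexCategory) (g : deltaToISOp.obj X ⟶ Y), freeSι C g ≫ a = freeSι C g ≫ b) :
    a = b :=
  (freeSIsColimit C Y).hom_ext fun g => h g.left g.hom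

/-- The map out of `F_𝒮(C)(Y)` given by a compatible family of maps. -/
noncomputable def freeSDesc (C : CosimpChain.{u}) (Y : ISCatᵒᵖ) {Z : Chain.{u}}
    (T : ∀ (X : SimplexCategory), (deltaToISOp.obj X ⟶ Y) → (C.obj X ⟶ Z))
    (hT : ∀ (X X' : SimplexCategory) (φ : X ⟶ X') (g : deltaToISOp.obj X' ⟶ Y),
      C.map φ ≫ T X' g = T X (deltaToISOp.map φ ≫ g)) : (freeS.obj C).obj Y ⟶ Z :=
  (freeSIsColimit C Y).desc
    { pt := Z
      ι :=
        { app := fun g => T g.left g.hom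
          naturality := fun g g' φ => by
            have h := hT _ _ φ.left g'.hom
            rw [CostructuredArrow.w φ] at h
            exact h.trans (Category.comp_id _).symm } }

theorem freeSι_desc (C : CosimpChain.{u}) (Y : ISCatᵒᵖ) {Z : Chain.{u}}
    (T : ∀ (X : SimplexCategory), (deltaToISOp.obj X ⟶ Y) → (C.obj X ⟶ Z))
    (hT : ∀ (X X' : SimplexCategory) (φ : X ⟶ X') (g : deltaToISOp.obj X' ⟶ Y),
      C.map φ ≫ T X' g = T X (deltaToISOp.map φ ≫ g)) {X : SimplexCategory}
    (g : deltaToISOp.obj X ⟶ Y) : freeSι C g ≫ freeSDesc C Y T hT = T X g :=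
  (freeSIsColimit C Y).fac _ (CostructuredArrow.mk g)

/-! ### The ordered initial segment of a generator -/

/-- The length of the ordered initial segment of the morphism of `IS` underlying `g`. -/
noncomputable def genLen {X Y : SimplexCategory} (g : deltaToISOp.obj X ⟶ deltaToISOp.obj Y) : ℕ :=
  ISHom.prefixLen (m := Y.len) (n := X.len) g.unop

theorem genLen_map_comp {X X' Y : SimplexCategory} (φ : X ⟶ X')
    (g : deltaToISOp.obj X' ⟶ deltaToISOp.obj Y) :
    genLen (deltaToISOp.map φ ≫ g) = genLen g :=
  ISHom.prefixLen_comp_ofMonotone (m := X'.len) (n := X.len) g.unop (joyalDual φ.toOrderHom)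
    (joyalDual_mono _) (joyalDual_zero _) (joyalDual_last _)

theorem genLen_comp_δ {X : SimplexCategory} {n : ℕ}
    (g : deltaToISOp.obj X ⟶ deltaToISOp.obj (SimplexCategory.mk n)) (i : Fin (n + 2)) :
    genLen (g ≫ deltaToISOp.map (SimplexCategory.δ i)) =
      if (i : ℕ) < genLen g then genLen g + 1 else genLen g :=
  ISHom.prefixLen_δ_comp (n := n) (m := X.len) i g.unop (joyalDual_mono _) (joyalDual_zero _)
    (joyalDual_last _)

theorem one_le_genLen {X Y : SimplexCategory} (g : deltaToISOp.obj X ⟶ deltaToISOp.obj Y) :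
    1 ≤ genLen g :=
  ISHom.one_le_prefixLen _

theorem genLen_le {X Y : SimplexCategory} (g : deltaToISOp.obj X ⟶ deltaToISOp.obj Y) :
    genLen g ≤ Y.len + 2 :=
  ISHom.prefixLen_le _

instance : deltaToISOp.Faithful where
  map_injective {X Y} φ ψ h := by
    apply SimplexCategory.Hom.ext
    apply joyalDual_injective
    exact congrArg (fun g => ISHom.toFun (m := Y.len) (n := X.len) g.unop) h

/-- The morphisms in the image of `Δ` are those whose total order is the natural order. -/
theorem exists_map_eq_iff {X Y : SimplexCategory} (g : deltaToISOp.obj X ⟶ deltaToISOp.obj Y) :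
    (∃ φ : X ⟶ Y, deltaToISOp.map φ = g) ↔ genLen g = Y.len + 2 := by
  refine Iff.trans ⟨?_, fun h => ?_⟩ (ISHom.prefixLen_eq_add_two_iff _).symm
  · rintro ⟨φ, rfl⟩
    exact ISHom.inOrder_ofMonotone _ (joyalDual_mono _) (joyalDual_zero _) (joyalDual_last _)
  · obtain ⟨he, h'⟩ := ISHom.exists_eq_ofMonotone _ h
    obtain ⟨φ, hφ⟩ := joyalDual_surjective _ he (ISHom.map_zero _) (ISHom.map_last _)
    refine ⟨SimplexCategory.Hom.mk φ, Quiver.Hom.unop_inj (Eq.trans ?_ h'.symm)⟩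
    change ISHom.ofMonotone (joyalDual φ) (joyalDual_mono _) (joyalDual_zero _)
      (joyalDual_last _) = _
    congr

/-! ### The retraction of the unit and the contracting homotopy -/

/-- The component of the unit in cosimplicial degree `n`. -/
noncomputable def freeSUnit (C : CosimpChain.{u}) (n : ℕ) :
    C.obj (SimplexCategory.mk n) ⟶ (freeS.obj C).obj (deltaToISOp.obj (SimplexCategory.mk n)) :=
  (freeSAdjunction.unit.app C).app (SimplexCategory.mk n)

theorem freeSUnit_eq (C : CosimpChain.{u}) (n : ℕ) :
    freeSUnit C n = freeSι C (𝟙 (deltaToISOp.obj (SimplexCategory.mk n))) := by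
  rw [freeSι, CategoryTheory.Functor.map_id]
  exact (Category.comp_id _).symm

/-- The alternating sum of the cofaces of `F_𝒮(C)`. -/
noncomputable def freeSCoface (C : CosimpChain.{u}) (n : ℕ) :
    (freeS.obj C).obj (deltaToISOp.obj (SimplexCategory.mk n)) ⟶
      (freeS.obj C).obj (deltaToISOp.obj (SimplexCategory.mk (n + 1))) :=
  cofaceSum (restrictS.obj (freeS.obj C)) n

open Classical in
/-- The projection of `F_𝒮(C)^n` to `C^n` which kills the summands of the nontrivial
permutations. -/
noncomputable def freeSRetract (C : CosimpChain.{u}) (n : ℕ) :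
    (freeS.obj C).obj (deltaToISOp.obj (SimplexCategory.mk n)) ⟶ C.obj (SimplexCategory.mk n) :=
  freeSDesc C _ (fun _ g => if h : ∃ φ, deltaToISOp.map φ = g then C.map h.choose else 0) (by
    intro X X' φ g
    by_cases h : ∃ ψ, deltaToISOp.map ψ = g
    · have h' : ∃ ψ, deltaToISOp.map ψ = deltaToISOp.map φ ≫ g :=
        ⟨φ ≫ h.choose, by rw [Functor.map_comp, h.choose_spec]⟩
      rw [dif_pos h, dif_pos h', ← Functor.map_comp]
      congr 1
      apply deltaToISOp.map_injective
      rw [Functor.map_comp, h.choose_spec, h'.choose_spec]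
    · have h' : ¬ ∃ ψ, deltaToISOp.map ψ = deltaToISOp.map φ ≫ g := by
        rwa [exists_map_eq_iff, genLen_map_comp, ← exists_map_eq_iff]
      rw [dif_neg h, dif_neg h', Limits.comp_zero])

theorem freeSι_map_retract (C : CosimpChain.{u}) (n : ℕ) {X : SimplexCategory}
    (φ : X ⟶ SimplexCategory.mk n) :
    freeSι C (deltaToISOp.map φ) ≫ freeSRetract C n = C.map φ := by
  have h : ∃ ψ, deltaToISOp.map ψ = deltaToISOp.map φ := ⟨φ, rfl⟩
  rw [freeSRetract, freeSι_desc, dif_pos h]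
  congr 1
  exact deltaToISOp.map_injective h.choose_spec

theorem freeSι_retract_of_not_exists (C : CosimpChain.{u}) (n : ℕ) {X : SimplexCategory}
    (g : deltaToISOp.obj X ⟶ deltaToISOp.obj (SimplexCategory.mk n))
    (h : ¬ ∃ φ, deltaToISOp.map φ = g) : freeSι C g ≫ freeSRetract C n = 0 := by
  rw [freeSRetract, freeSι_desc, dif_neg h]

/-- The homotopy `F_𝒮(C)^(n+1) → F_𝒮(C)^n`: on the generators with ordered initial segment of
length `t`, it is the codegeneracy `(-1)^t s_(t-2)`. -/
noncomputable def freeSContract (C : CosimpChain.{u}) (n : ℕ) :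
    (freeS.obj C).obj (deltaToISOp.obj (SimplexCategory.mk (n + 1))) ⟶
      (freeS.obj C).obj (deltaToISOp.obj (SimplexCategory.mk n)) :=
  freeSDesc C _ (fun _ g => freeSι C g ≫ signedσ (deltaToISOp ⋙ freeS.obj C) n (genLen g)) (by
    intro X X' φ g
    rw [genLen_map_comp, ← reassoc_of% @map_freeSι])

theorem freeSι_contract (C : CosimpChain.{u}) (n : ℕ) {X : SimplexCategory}
    (g : deltaToISOp.obj X ⟶ deltaToISOp.obj (SimplexCategory.mk (n + 1))) :
    freeSι C g ≫ freeSContract C n =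
      freeSι C g ≫ signedσ (deltaToISOp ⋙ freeS.obj C) n (genLen g) :=
  freeSι_desc C _ _ _ g

theorem freeSι_comp_cofaceSum (C : CosimpChain.{u}) (n : ℕ) {X : SimplexCategory}
    (g : deltaToISOp.obj X ⟶ deltaToISOp.obj (SimplexCategory.mk n)) :
    freeSι C g ≫ freeSCoface C n =
      ∑ i : Fin (n + 2), (-1 : ℤ) ^ (i : ℕ) •
        freeSι C (g ≫ deltaToISOp.map (SimplexCategory.δ i)) := by
  rw [freeSCoface, cofaceSum, Preadditive.comp_sum]
  refine Finset.sum_congr rfl fun i _ => ?_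
  rw [Preadditive.comp_zsmul, ← freeSι_map]
  rfl

theorem exists_map_eq_comp_δ_iff {X : SimplexCategory} {n : ℕ}
    (g : deltaToISOp.obj X ⟶ deltaToISOp.obj (SimplexCategory.mk n)) (i : Fin (n + 2)) :
    (∃ φ, deltaToISOp.map φ = g ≫ deltaToISOp.map (SimplexCategory.δ i)) ↔
      ∃ φ, deltaToISOp.map φ = g := by
  rw [exists_map_eq_iff, exists_map_eq_iff, genLen_comp_δ]
  have := genLen_le g
  simp only at this ⊢
  split_ifs <;> omega

theorem cofaceSum_comp_freeSRetract (C : CosimpChain.{u}) (n : ℕ) :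
    freeSCoface C n ≫ freeSRetract C (n + 1) =
      freeSRetract C n ≫ cofaceSum C n := by
  refine freeS_hom_ext C fun X g => ?_
  rw [reassoc_of% @freeSι_comp_cofaceSum, Preadditive.sum_comp]
  by_cases h : ∃ φ, deltaToISOp.map φ = g
  · obtain ⟨φ, rfl⟩ := h
    rw [reassoc_of% @freeSι_map_retract, cofaceSum, Preadditive.comp_sum]
    refine Finset.sum_congr rfl fun i _ => ?_
    rw [← Functor.map_comp, Preadditive.zsmul_comp, freeSι_map_retract, Functor.map_comp,
      Preadditive.comp_zsmul]
  · rw [reassoc_of% freeSι_retract_of_not_exists C n g h, Limits.zero_comp]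
    refine Finset.sum_eq_zero fun i _ => ?_
    rw [Preadditive.zsmul_comp, freeSι_retract_of_not_exists, smul_zero]
    rwa [exists_map_eq_comp_δ_iff]

theorem unit_comp_freeSRetract (C : CosimpChain.{u}) (n : ℕ) :
    freeSUnit C n ≫ freeSRetract C n = 𝟙 _ := by
  have h := freeSι_map_retract C n (𝟙 (SimplexCategory.mk n))
  rw [CategoryTheory.Functor.map_id, CategoryTheory.Functor.map_id] at h
  rw [freeSUnit_eq]
  exact h

theorem freeSι_comp_cofaceSum_contract (C : CosimpChain.{u}) (n : ℕ) {X : SimplexCategory}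
    (g : deltaToISOp.obj X ⟶ deltaToISOp.obj (SimplexCategory.mk n)) :
    freeSι C g ≫ freeSCoface C n ≫ freeSContract C n =
      freeSι C g ≫ ∑ i : Fin (n + 2), (-1 : ℤ) ^ (i : ℕ) •
        (deltaToISOp ⋙ freeS.obj C).map (SimplexCategory.δ i) ≫
          signedσ (deltaToISOp ⋙ freeS.obj C) n
            (if (i : ℕ) < genLen g then genLen g + 1 else genLen g) := by
  rw [reassoc_of% @freeSι_comp_cofaceSum, Preadditive.sum_comp, Preadditive.comp_sum]
  refine Finset.sum_congr rfl fun i _ => ?_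
  rw [Preadditive.zsmul_comp, freeSι_contract, genLen_comp_δ, Preadditive.comp_zsmul,
    ← reassoc_of% @freeSι_map]
  rfl

theorem freeSι_comp_retract_unit (C : CosimpChain.{u}) (n : ℕ) {X : SimplexCategory}
    (g : deltaToISOp.obj X ⟶ deltaToISOp.obj (SimplexCategory.mk n)) :
    freeSι C g ≫ freeSRetract C n ≫ freeSUnit C n =
      if genLen g = n + 2 then freeSι C g else 0 := by
  split_ifs with h
  · obtain ⟨φ, rfl⟩ := (exists_map_eq_iff g).2 h
    rw [reassoc_of% @freeSι_map_retract, freeSUnit_eq, map_freeSι, Category.comp_id]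
  · rw [reassoc_of% @freeSι_retract_of_not_exists, Limits.zero_comp]
    rwa [exists_map_eq_iff]

theorem freeS_homotopy_zero (C : CosimpChain.{u}) :
    freeSCoface C 0 ≫ freeSContract C 0 +
      freeSRetract C 0 ≫ freeSUnit C 0 = 𝟙 _ := by
  refine freeS_hom_ext C fun X g => ?_
  -- The interval with two points has only one admissible order.
  have h : genLen g = 0 + 2 := ISHom.prefixLen_eq_two _
  rw [Preadditive.comp_add, freeSι_comp_retract_unit, if_pos h, freeSι_comp_cofaceSum_contract,
    Finset.sum_eq_zero, Limits.comp_zero, zero_add]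
  · exact (Category.comp_id _).symm
  · intro i _
    rw [signedσ_of_lt, Limits.comp_zero, smul_zero]
    have := i.2
    split_ifs <;> omega

theorem freeS_homotopy_succ (C : CosimpChain.{u}) (n : ℕ) :
    freeSCoface C (n + 1) ≫ freeSContract C (n + 1) +
      freeSContract C n ≫ freeSCoface C n +
      freeSRetract C (n + 1) ≫ freeSUnit C (n + 1) =
        𝟙 _ := by
  refine freeS_hom_ext C fun X g => ?_
  rw [Preadditive.comp_add, Preadditive.comp_add, freeSι_comp_retract_unit,
    freeSι_comp_cofaceSum_contract, reassoc_of% @freeSι_contract]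
  have hle := genLen_le g
  simp only at hle
  split_ifs with h
  · rw [signedσ_of_lt _ n _ (by omega), Limits.zero_comp, Limits.comp_zero, Finset.sum_eq_zero,
      Limits.comp_zero, zero_add, zero_add]
    · exact (Category.comp_id _).symm
    · intro i _
      rw [signedσ_of_lt, Limits.comp_zero, smul_zero]
      have := i.2
      split_ifs <;> omega
  · rw [add_zero, ← Preadditive.comp_add]
    exact congrArg (freeSι C g ≫ ·) (sum_δ_signedσ (deltaToISOp ⋙ freeS.obj C) n (genLen g)
      (one_le_genLen g) (by omega))

/-! ### Naturality -/

theorem freeSRetract_naturality {C D : CosimpChain.{u}} (α : C ⟶ D) (n : ℕ) :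
    (freeS.map α).app (deltaToISOp.obj (SimplexCategory.mk n)) ≫ freeSRetract D n =
      freeSRetract C n ≫ α.app (SimplexCategory.mk n) := by
  refine freeS_hom_ext C fun X g => ?_
  rw [reassoc_of% @freeSι_naturality]
  by_cases h : ∃ φ, deltaToISOp.map φ = g
  · obtain ⟨φ, rfl⟩ := h
    rw [freeSι_map_retract, reassoc_of% @freeSι_map_retract, α.naturality]
  · rw [freeSι_retract_of_not_exists D n g h, reassoc_of% freeSι_retract_of_not_exists C n g h,
      Limits.comp_zero, Limits.zero_comp]

theorem signedσ_naturality {A : Type*} [Category A] [Preadditive A] {G H : SimplexCategory ⥤ A}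
    (α : G ⟶ H) (n t : ℕ) :
    α.app _ ≫ signedσ H n t = signedσ G n t ≫ α.app _ := by
  unfold signedσ
  split_ifs
  · rw [Preadditive.comp_zsmul, Preadditive.zsmul_comp, α.naturality]
  · rw [Limits.comp_zero, Limits.zero_comp]

theorem freeSContract_naturality {C D : CosimpChain.{u}} (α : C ⟶ D) (n : ℕ) :
    (freeS.map α).app (deltaToISOp.obj (SimplexCategory.mk (n + 1))) ≫ freeSContract D n =
      freeSContract C n ≫ (freeS.map α).app (deltaToISOp.obj (SimplexCategory.mk n)) := by
  refine freeS_hom_ext C fun X g => ?_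
  rw [reassoc_of% @freeSι_naturality, freeSι_contract, reassoc_of% @freeSι_contract,
    ← reassoc_of% @freeSι_naturality]
  exact congrArg (freeSι C g ≫ ·)
    (signedσ_naturality (Functor.whiskerLeft deltaToISOp (freeS.map α)) n (genLen g))

/-! ### Maps and homotopies of total complexes -/

section Tot

variable {C D : CosimpChain.{u}}

/-- The map of total complexes induced by chain maps `C^n → D^n`, which need not commute with the
individual cofaces and codegeneracies. -/
def totMapOf (f : ∀ n, C.obj (SimplexCategory.mk n) ⟶ D.obj (SimplexCategory.mk n)) (m : ℤ) :
    TotX C m →ₗ[ℤ] TotX D m where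
  toFun a := fun p => ((f p.1.1).f p.1.2).hom (a p)
  map_add' a b := by
    funext p
    simp
  map_smul' c a := by
    funext p
    simp

theorem verticalD_comp_hom {n n' : ℕ}
    (f : C.obj (SimplexCategory.mk n) ⟶ D.obj (SimplexCategory.mk n')) (k : ℤ)
    (x : (C.obj (SimplexCategory.mk n)).X (k + 1)) :
    (f.f k).hom (verticalD C n k x) = verticalD D n' k ((f.f (k + 1)).hom x) :=
  (congrArg (fun g => g.hom x) (f.comm (k + 1) k)).symm

theorem totMapOf_totD (f : ∀ n, C.obj (SimplexCategory.mk n) ⟶ D.obj (SimplexCategory.mk n))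
    (hf : ∀ n, cofaceSum C n ≫ f (n + 1) = f n ≫ cofaceSum D n) (m : ℤ) (a : TotX C m) :
    totMapOf f (m + 1) (totD C m a) = totD D m (totMapOf f m a) := by
  funext ⟨⟨n, k⟩, h⟩
  match n, h with
  | 0, h =>
    change ((f 0).f k).hom (- verticalD C 0 k _) = - verticalD D 0 k _
    rw [map_neg, verticalD_comp_hom]
    rfl
  | n + 1, h =>
    change ((f (n + 1)).f k).hom (horizontalD C n k _ - verticalD C (n + 1) k _) =
        horizontalD D n k _ - verticalD D (n + 1) k _
    have h' : ∀ x, ((f (n + 1)).f k).hom (((cofaceSum C n).f k).hom x) =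
        ((cofaceSum D n).f k).hom (((f n).f k).hom x) := fun x =>
      congrArg (fun g => (g.f k).hom x) (hf n)
    rw [map_sub, verticalD_comp_hom, horizontalD_apply, horizontalD_apply, map_zsmul, h']
    rfl

/-- The homotopy of total complexes induced by chain maps `C^(n+1) → C^n`. The sign `(-1)^k` makes
it anticommute with the vertical differential. -/
def totContract (h : ∀ n, C.obj (SimplexCategory.mk (n + 1)) ⟶ C.obj (SimplexCategory.mk n))
    (i j : ℤ) (hij : j + 1 = i) : TotX C i →ₗ[ℤ] TotX C j where
  toFun a := fun p => ((p.1.2.negOnePow : ℤˣ) : ℤ) • ((h p.1.1).f p.1.2).hom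
    (a ⟨(p.1.1 + 1, p.1.2), by have := p.2; push_cast; omega⟩)
  map_add' a b := by
    funext p
    exact (congrArg _ (map_add _ _ _)).trans (zsmul_add _ _ _)
  map_smul' c a := by
    funext p
    simp [smul_comm c]

theorem negOnePow_smul_negOnePow_smul {M : Type*} [AddCommGroup M] (k : ℤ) (x : M) :
    ((k.negOnePow : ℤˣ) : ℤ) • ((k.negOnePow : ℤˣ) : ℤ) • x = x := by
  rw [smul_smul, ← Units.val_mul, Int.units_mul_self, Units.val_one, one_smul]

theorem totContract_homotopy
    (h : ∀ n, C.obj (SimplexCategory.mk (n + 1)) ⟶ C.obj (SimplexCategory.mk n))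
    (f : ∀ n, C.obj (SimplexCategory.mk n) ⟶ C.obj (SimplexCategory.mk n))
    (h0 : cofaceSum C 0 ≫ h 0 + f 0 = 𝟙 _)
    (hsucc : ∀ n, cofaceSum C (n + 1) ≫ h (n + 1) + h n ≫ cofaceSum C n + f (n + 1) = 𝟙 _)
    (m : ℤ) (a : TotX C (m + 1)) :
    totContract h (m + 1 + 1) (m + 1) rfl (totD C (m + 1) a) +
      totD C m (totContract h (m + 1) m rfl a) + totMapOf f (m + 1) a = a := by
  funext ⟨⟨n, k⟩, hp⟩
  match n, hp with
  | 0, hp =>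
    have h' : ∀ x, ((h 0).f k).hom (((cofaceSum C 0).f k).hom x) + ((f 0).f k).hom x = x :=
      fun x => congrArg (fun g => (g.f k).hom x) h0
    change ((k.negOnePow : ℤˣ) : ℤ) • ((h 0).f k).hom (horizontalD C 0 k _ - verticalD C 1 k _) +
      - verticalD C 0 k ((((k + 1).negOnePow : ℤˣ) : ℤ) • ((h 0).f (k + 1)).hom _) +
      ((f 0).f k).hom _ = _
    refine Eq.trans ?_ (h' _)
    congr 1
    rw [map_sub, verticalD_comp_hom, horizontalD_apply, map_zsmul, map_zsmul, zsmul_sub,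
      negOnePow_smul_negOnePow_smul, Int.negOnePow_succ, Units.val_neg, neg_zsmul]
    abel
  | n + 1, hp =>
    have h' : ∀ x, ((h (n + 1)).f k).hom (((cofaceSum C (n + 1)).f k).hom x) +
        ((cofaceSum C n).f k).hom (((h n).f k).hom x) + ((f (n + 1)).f k).hom x = x :=
      fun x => congrArg (fun g => (g.f k).hom x) (hsucc n)
    change ((k.negOnePow : ℤˣ) : ℤ) • ((h (n + 1)).f k).hom
        (horizontalD C (n + 1) k _ - verticalD C (n + 1 + 1) k _) +
      (horizontalD C n k (((k.negOnePow : ℤˣ) : ℤ) • ((h n).f k).hom _) -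
        verticalD C (n + 1) k ((((k + 1).negOnePow : ℤˣ) : ℤ) • ((h (n + 1)).f (k + 1)).hom _)) +
      ((f (n + 1)).f k).hom _ = _
    refine Eq.trans ?_ (h' _)
    congr 1
    rw [map_sub, verticalD_comp_hom, horizontalD_apply, horizontalD_apply, map_zsmul, map_zsmul,
      map_zsmul, zsmul_sub, negOnePow_smul_negOnePow_smul, negOnePow_smul_negOnePow_smul,
      Int.negOnePow_succ, Units.val_neg, neg_zsmul]
    abel

theorem totFunctor_obj_d (C : CosimpChain.{u}) (m : ℤ) :
    (totFunctor.obj C).d m (m + 1) = ModuleCat.ofHom (totD C m) :=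
  CochainComplex.of_d (fun m => ModuleCat.of ℤ (TotX C m)) (fun m => ModuleCat.ofHom (totD C m)) m

/-- The cochain map of total complexes induced by chain maps `C^n → D^n` which commute with the
alternating sums of the cofaces. -/
def totHomOf (f : ∀ n, C.obj (SimplexCategory.mk n) ⟶ D.obj (SimplexCategory.mk n))
    (hf : ∀ n, cofaceSum C n ≫ f (n + 1) = f n ≫ cofaceSum D n) :
    totFunctor.obj C ⟶ totFunctor.obj D :=
  CochainComplex.ofHom (fun m => ModuleCat.ofHom (totMapOf f m)) (fun m => by
    rw [totFunctor_obj_d, totFunctor_obj_d]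
    apply ModuleCat.hom_ext
    exact LinearMap.ext fun a => (totMapOf_totD f hf m a).symm)

/-- The components of the homotopy of total complexes induced by chain maps `C^(n+1) → C^n`. -/
def totContractHom
    (h : ∀ n, C.obj (SimplexCategory.mk (n + 1)) ⟶ C.obj (SimplexCategory.mk n)) (i j : ℤ) :
    (totFunctor.obj C).X i ⟶ (totFunctor.obj C).X j :=
  if hij : j + 1 = i then ModuleCat.ofHom (totContract h i j hij) else 0

theorem totContractHom_add_one
    (h : ∀ n, C.obj (SimplexCategory.mk (n + 1)) ⟶ C.obj (SimplexCategory.mk n)) (j : ℤ) :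
    totContractHom h (j + 1) j = ModuleCat.ofHom (totContract h (j + 1) j rfl) :=
  dif_pos rfl

theorem totContractHom_of_ne
    (h : ∀ n, C.obj (SimplexCategory.mk (n + 1)) ⟶ C.obj (SimplexCategory.mk n)) {i j : ℤ}
    (hij : ¬ j + 1 = i) : totContractHom h i j = 0 :=
  dif_neg hij

/-- If the maps `f n` and `h n` satisfy `d h + h d + f = 1` for the alternating sums of the
cofaces, then the endomorphism of the total complex given by `f` is homotopic to the identity. -/
def totHomotopy (h : ∀ n, C.obj (SimplexCategory.mk (n + 1)) ⟶ C.obj (SimplexCategory.mk n))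
    (f : ∀ n, C.obj (SimplexCategory.mk n) ⟶ C.obj (SimplexCategory.mk n))
    (h0 : cofaceSum C 0 ≫ h 0 + f 0 = 𝟙 _)
    (hsucc : ∀ n, cofaceSum C (n + 1) ≫ h (n + 1) + h n ≫ cofaceSum C n + f (n + 1) = 𝟙 _)
    (F : totFunctor.obj C ⟶ totFunctor.obj C) (hF : ∀ m a, (F.f m).hom a = totMapOf f m a) :
    Homotopy F (𝟙 _) where
  hom i j := - totContractHom h i j
  zero i j hij := by
    rw [totContractHom_of_ne h hij, neg_zero]
  comm i := by
    obtain ⟨m, rfl⟩ : ∃ m, i = m + 1 := ⟨i - 1, by omega⟩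
    have h1 : (ComplexShape.up ℤ).Rel (m + 1) (m + 1 + 1) := rfl
    have h2 : (ComplexShape.up ℤ).Rel m (m + 1) := rfl
    rw [dNext_eq _ h1, prevD_eq _ h2, totFunctor_obj_d, totFunctor_obj_d, totContractHom_add_one,
      totContractHom_add_one]
    apply ModuleCat.hom_ext
    refine LinearMap.ext fun (a : TotX C (m + 1)) => (hF _ a).trans ?_
    change _ = - (totContract h (m + 1 + 1) (m + 1) rfl (totD C (m + 1) a)) +
      totD C m (- totContract h (m + 1) m rfl a) + a
    rw [map_neg]
    conv_rhs => rhs; rw [← totContract_homotopy h f h0 hsucc m a]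
    abel

end Tot

/-! ### The natural homotopy equivalence -/

/-- The cochain map `Tot(F_𝒮(C)) → Tot(C)` induced by the retraction. -/
noncomputable def totRetract :
    freeS.{u} ⋙ restrictS.{u} ⋙ totFunctor.{u} ⟶ totFunctor.{u} where
  app C := totHomOf (C := restrictS.obj (freeS.obj C)) (freeSRetract C)
    (cofaceSum_comp_freeSRetract C)
  naturality C D α := by
    ext m a
    funext p
    exact congrArg (fun g => (g.f p.1.2).hom (a p)) (freeSRetract_naturality α p.1.1)

/-- The cochain map `Tot(C) → Tot(F_𝒮(C))` induced by the unit. -/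
noncomputable def totUnit :
    totFunctor.{u} ⟶ freeS.{u} ⋙ restrictS.{u} ⋙ totFunctor.{u} :=
  Functor.whiskerRight freeSAdjunction.unit totFunctor

theorem totUnit_comp_totRetract : totUnit.{u} ≫ totRetract = 𝟙 _ := by
  ext C m a
  funext p
  exact congrArg (fun g => (g.f p.1.2).hom (a p)) (unit_comp_freeSRetract C p.1.1)

/-- The natural homotopy from `ι r` to the identity of `Tot(F_𝒮(C))`. -/
noncomputable def totRetractHomotopy : NatHomotopy (totRetract.{u} ≫ totUnit) (𝟙 _) where
  homotopy C := totHomotopy (C := restrictS.obj (freeS.obj C)) (freeSContract C)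
    (fun n => freeSRetract C n ≫ freeSUnit C n) (freeS_homotopy_zero C) (freeS_homotopy_succ C) _
    fun _ _ => rfl
  naturality {C D} α i j := by
    change _ ≫ (- totContractHom (C := restrictS.obj (freeS.obj D)) (freeSContract D) i j) =
      (- totContractHom (C := restrictS.obj (freeS.obj C)) (freeSContract C) i j) ≫ _
    rw [Preadditive.comp_neg, Preadditive.neg_comp]
    congr 1
    by_cases hij : j + 1 = i
    · subst hij
      rw [totContractHom_add_one, totContractHom_add_one]
      apply ModuleCat.hom_ext
      refine LinearMap.ext fun a => ?_
      funext ⟨⟨n, k⟩, hp⟩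
      have h' : ∀ x, ((freeSContract D n).f k).hom (((freeS.map α).app
            (deltaToISOp.obj (SimplexCategory.mk (n + 1)))).f k |>.hom x) =
          (((freeS.map α).app (deltaToISOp.obj (SimplexCategory.mk n))).f k).hom
            (((freeSContract C n).f k).hom x) := fun x =>
        congrArg (fun g => (g.f k).hom x) (freeSContract_naturality α n)
      refine Eq.trans (congrArg (((k.negOnePow : ℤˣ) : ℤ) • ·) (h' _))
        (map_zsmul (((freeS.map α).app (deltaToISOp.obj (SimplexCategory.mk n))).f k).hom _ _).symm
    · rw [totContractHom_of_ne _ hij, totContractHom_of_ne _ hij, Limits.comp_zero,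
        Limits.zero_comp]

/-- A natural homotopy restricts along a functor between the sources. -/
def NatHomotopy.whiskerLeft {D : Type*} [Category D] {E : Type*} [Category E]
    {F G : E ⥤ CochainComplex (ModuleCat.{u} ℤ) ℤ} {α β : F ⟶ G} (h : NatHomotopy α β)
    (K : D ⥤ E) : NatHomotopy (Functor.whiskerLeft K α) (Functor.whiskerLeft K β) where
  homotopy X := h.homotopy (K.obj X)
  naturality φ i j := h.naturality (K.map φ) i j

/-- Equal natural transformations are naturally homotopic. -/
def NatHomotopy.ofEq {D : Type*} [Category D] {F G : D ⥤ CochainComplex (ModuleCat.{u} ℤ) ℤ}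
    {α β : F ⟶ G} (h : α = β) : NatHomotopy α β where
  homotopy X := Homotopy.ofEq (by rw [h])
  naturality _ _ _ := by
    change _ ≫ 0 = 0 ≫ _
    rw [Limits.comp_zero, Limits.zero_comp]

theorem mainTheorem2 :
    ∃ e : NatHomotopyEquiv
        (HasFGTorsionFreeComponents.{u}.ι ⋙ freeS.{u} ⋙ restrictS.{u} ⋙ totFunctor.{u})
        (HasFGTorsionFreeComponents.{u}.ι ⋙ totFunctor.{u}),
      ∀ C : HasFGTorsionFreeComponents.{u}.FullSubcategory,
        e.inv.app C = totFunctor.{u}.map (freeSAdjunction.{u}.unit.app C.obj) := by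
  refine ⟨{ hom := Functor.whiskerLeft _ totRetract
            inv := Functor.whiskerLeft _ totUnit
            homotopyHomInvId := totRetractHomotopy.whiskerLeft _
            homotopyInvHomId :=
              NatHomotopy.whiskerLeft (NatHomotopy.ofEq totUnit_comp_totRetract) _ },
    fun C => rfl⟩
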